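/- For integers $x$ and $k$ let $\binom{x}{k}=\frac{x(x-1)\cdots(x-k+1)}{k!}$ if $k\ge 0$ and $\binom{x}{k}=0$ if $k<0$; a sum $\sum_{i=1}^{N}$ with $N<1$ is $0$. Then for all positive integers $m$, $n$ and $r$, $$\sum_{a=1}^{m-r}\sum_{b=1}^{n-r}\binom{2m-a+b-1}{m-r-a}\binom{2n+a-b-1}{n-r-b} =\frac{mn}{2(m+n)}\binom{2m}{m}\binom{2n}{n}-\frac{r}{2}\binom{2m+2n}{m+n}+\frac{r}{2}\binom{2m}{m}\binom{2n}{n}+\sum_{k=1}^{r-1}(r-k)\binom{2m}{m-k}\binom{2n}{n-k}.$$ -/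

import Mathlib

/-- The binomial coefficient `x (x - 1) ⋯ (x - k + 1) / k!` for integers `x` and `k`,
equal to `0` when `k < 0`. -/
noncomputable def binom (x k : ℤ) : ℤ :=
  if k < 0 then 0 else Ring.choose x k.toNat

open Finset

/-! Write B_k = C(2m, m-k) C(2n, n-k). The double sum equals the tail ∑_{k>r} (k-r) B_k: by Pascal's
rule, its summand is the mixed difference in (M, N) of `weightedSum`
(`weightedSum_second_difference`), so both sums telescope. The tail is ∑_{k≥1} (k-r) B_k plus the
correction ∑_{k<r} (r-k) B_k. Here ∑ B_k comes from Vandermonde and the symmetry of B, and ∑ k B_k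
telescopes by absorption. -/

theorem binom_of_neg {x k : ℤ} (hk : k < 0) : binom x k = 0 := by
  simp [binom, hk]

theorem binom_natCast (x k : ℕ) : binom x k = x.choose k := by
  simp [binom, Ring.choose_natCast]

/-- Pascal's rule, for all integers. -/
theorem binom_succ (x k : ℤ) : binom (x + 1) k = binom x k + binom x (k - 1) := by
  rcases lt_trichotomy k 0 with hk | rfl | hk
  · rw [binom_of_neg hk, binom_of_neg hk, binom_of_neg (by lia), add_zero]
  · simp [binom]
  · obtain ⟨j, rfl⟩ : ∃ j : ℕ, k = j + 1 := ⟨(k - 1).toNat, by lia⟩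
    have h0 : ¬ ((j : ℤ) + 1 < 0) := by lia
    have h1 : ((j : ℤ) + 1).toNat = j + 1 := by lia
    simp [binom, h0, h1, Ring.choose_succ_succ, add_comm]

theorem binom_symm (x : ℕ) (k : ℤ) : binom x (x - k) = binom x k := by
  rcases lt_or_ge k 0 with hk | hk
  · obtain ⟨j, hj⟩ : ∃ j : ℕ, (x : ℤ) - k = j := ⟨(x - k).toNat, by lia⟩
    rw [binom_of_neg hk, hj, binom_natCast, Nat.choose_eq_zero_of_lt (by lia), Nat.cast_zero]
  · lift k to ℕ using hk
    rcases le_or_gt k x with h | h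
    · rw [← Nat.cast_sub h, binom_natCast, binom_natCast, Nat.choose_symm h]
    · rw [binom_of_neg (by lia), binom_natCast, Nat.choose_eq_zero_of_lt h, Nat.cast_zero]

/-- The absorption identity `(k + 1) C(x, k + 1) = (x - k) C(x, k)`. -/
theorem binom_absorb (x : ℕ) (k : ℤ) : (k + 1) * binom x (k + 1) = (x - k) * binom x k := by
  rcases lt_trichotomy (k + 1) 0 with hk | hk | hk
  · rw [binom_of_neg hk, binom_of_neg (by lia), mul_zero, mul_zero]
  · rw [hk, binom_of_neg (show k < 0 by lia), zero_mul, mul_zero]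
  · lift k to ℕ using by lia
    rw [← Nat.cast_succ, binom_natCast, binom_natCast]
    rcases le_or_gt k x with h | h
    · have := Nat.choose_succ_right_eq x k
      rw [← Nat.cast_sub h]
      push_cast
      exact_mod_cast (by rw [mul_comm, this, mul_comm] :
        (k + 1) * x.choose (k + 1) = (x - k) * x.choose k)
    · rw [Nat.choose_eq_zero_of_lt h, Nat.choose_eq_zero_of_lt (by lia)]
      simp

/-- A second difference weighted by the index telescopes. -/
theorem sum_range_mul_second_difference (D : ℤ → ℤ) (L : ℕ) :
    ∑ k ∈ range L, ((k : ℤ) + 1) * (D k - 2 * D (k + 1) + D (k + 2))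
      = D 0 - (L + 1) * D L + L * D (L + 1) := by
  induction L with
  | zero => simp
  | succ L ih =>
    rw [sum_range_succ, ih]
    push_cast
    rw [show (L : ℤ) + 1 + 1 = L + 2 by ring]
    ring

/-- The partial sum `∑ k C(p + M - N, M - k) C(p + N - M, N - k)` over `1 ≤ k ≤ L`. -/
noncomputable def weightedSum (L : ℕ) (p M N : ℤ) : ℤ :=
  ∑ k ∈ range L, ((k : ℤ) + 1) *
    (binom (p + M - N) (M - (k + 1)) * binom (p + N - M) (N - (k + 1)))

/-- For fixed p, Pascal's rule turns the mixed difference of each term into a second difference in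
k. The weight k + 1 then leaves only the value at k = 0, because M < L kills the far boundary terms.
-/
theorem weightedSum_second_difference (L : ℕ) (p M N : ℤ) (hL : M < L) :
    weightedSum L p (M + 1) (N + 1) - weightedSum L p M (N + 1)
        - (weightedSum L p (M + 1) N - weightedSum L p M N)
      = binom (p - 1 + M - N) M * binom (p - 1 + N - M) N := by
  have h := sum_range_mul_second_difference
    (fun k => binom (p - 1 + M - N) (M - k) * binom (p - 1 + N - M) (N - k)) L
  simp only [binom_of_neg (show M - (L : ℤ) < 0 by lia),
    binom_of_neg (show M - ((L : ℤ) + 1) < 0 by lia), zero_mul, mul_zero, sub_zero,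
    add_zero] at h
  rw [← h]
  simp only [weightedSum]
  rw [← sum_sub_distrib, ← sum_sub_distrib, ← sum_sub_distrib]
  refine sum_congr rfl fun k _ => ?_
  generalize hq : p - 1 + M - N = q
  generalize hs : p - 1 + N - M = s
  rw [show p + (M + 1) - (N + 1) = q + 1 by lia, show p + (N + 1) - (M + 1) = s + 1 by lia,
    show p + M - (N + 1) = q by lia, show p + (N + 1) - M = s + 1 + 1 by lia,
    show p + (M + 1) - N = q + 1 + 1 by lia, show p + N - (M + 1) = s by lia,
    show p + M - N = q + 1 by lia, show p + N - M = s + 1 by lia]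
  simp only [binom_succ]
  rw [show M + 1 - ((k : ℤ) + 1) = M - k by ring, show N + 1 - ((k : ℤ) + 1) = N - k by ring,
    show M - (k : ℤ) - 1 = M - (k + 1) by ring, show N - (k : ℤ) - 1 = N - (k + 1) by ring,
    show M - ((k : ℤ) + 1) - 1 = M - (k + 2) by ring,
    show N - ((k : ℤ) + 1) - 1 = N - (k + 2) by ring]
  ring

theorem double_sum_eq_weightedSum (L M N : ℕ) (p : ℤ) (hL : M ≤ L) :
    ∑ i ∈ range M, ∑ j ∈ range N, binom (p - 1 + i - j) i * binom (p - 1 + j - i) j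
      = weightedSum L p M N := by
  have hN (x : ℤ) : weightedSum L p x 0 = 0 :=
    sum_eq_zero fun k _ => by
      rw [binom_of_neg (show (0 : ℤ) - (k + 1) < 0 by lia), mul_zero, mul_zero]
  have hM (x : ℤ) : weightedSum L p 0 x = 0 :=
    sum_eq_zero fun k _ => by
      rw [binom_of_neg (show (0 : ℤ) - (k + 1) < 0 by lia), zero_mul, mul_zero]
  have inner : ∀ i ∈ range M,
      ∑ j ∈ range N, binom (p - 1 + i - j) i * binom (p - 1 + j - i) j
        = weightedSum L p (i + 1 : ℕ) N - weightedSum L p i N := by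
    intro i hi
    have := sum_range_sub (fun j : ℕ => weightedSum L p (i + 1) j - weightedSum L p i j) N
    simp only [Nat.cast_zero, hN, sub_zero] at this
    push_cast
    rw [← this]
    refine sum_congr rfl fun j _ => ?_
    rw [mem_range] at hi
    push_cast
    exact (weightedSum_second_difference L p i j (by lia)).symm
  rw [sum_congr rfl inner, sum_range_sub (fun i : ℕ => weightedSum L p i N)]
  simp [hM]

theorem sum_Icc_one_eq_sum_range {A : Type*} [AddCommMonoid A] (f : ℤ → A) (M : ℕ) :
    ∑ a ∈ Icc (1 : ℤ) M, f a = ∑ i ∈ range M, f (i + 1) := by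
  refine sum_nbij' (fun a => (a - 1).toNat) (fun i => (i : ℤ) + 1) ?_ ?_ ?_ ?_ ?_ <;>
    simp only [mem_Icc, mem_range]
  · lia
  · lia
  · lia
  · lia
  · intro a ha
    congr 1
    lia

theorem sum_Icc_one_eq_sum_range_reflect {A : Type*} [AddCommMonoid A] (f : ℤ → A) (M : ℕ) :
    ∑ a ∈ Icc (1 : ℤ) M, f a = ∑ i ∈ range M, f (M - i) := by
  refine sum_nbij' (fun a => (M - a).toNat) (fun i => (M : ℤ) - i) ?_ ?_ ?_ ?_ ?_ <;>
    simp only [mem_Icc, mem_range]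
  · lia
  · lia
  · lia
  · lia
  · intro a ha
    congr 1
    lia

theorem sum_Icc_neg_of_even (B : ℤ → ℤ) (hB : ∀ k, B (-k) = B k) (K : ℕ) :
    ∑ k ∈ Icc (-(K : ℤ)) K, B k = B 0 + 2 * ∑ j ∈ range K, B (j + 1) := by
  induction K with
  | zero => simp
  | succ K ih =>
    have : Icc (-((K + 1 : ℕ) : ℤ)) (K + 1 : ℕ)
        = insert (-((K : ℤ) + 1)) (insert ((K : ℤ) + 1) (Icc (-(K : ℤ)) K)) := by
      ext x
      simp only [mem_insert, mem_Icc]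
      lia
    rw [this, sum_insert, sum_insert, ih, sum_range_succ, hB]
    · ring
    · simp
    · simp only [mem_insert, mem_Icc]
      lia

/-- The product `C(2m, m - k) C(2n, n - k)`. -/
noncomputable def centralProd (m n : ℕ) (k : ℤ) : ℤ :=
  binom (2 * m) (m - k) * binom (2 * n) (n - k)

theorem binom_central_neg (m : ℕ) (k : ℤ) :
    binom (2 * m) (m - -k) = binom (2 * m) (m - k) := by
  have := binom_symm (2 * m) (m - k)
  push_cast at this
  rw [← this]
  congr 1
  ring

theorem centralProd_neg (m n : ℕ) (k : ℤ) : centralProd m n (-k) = centralProd m n k := by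
  rw [centralProd, binom_central_neg, binom_central_neg, centralProd]

theorem centralProd_eq_zero {m n : ℕ} {k : ℤ} (h : (m : ℤ) < k ∨ (n : ℤ) < k) :
    centralProd m n k = 0 := by
  rcases h with h | h
  · rw [centralProd, binom_of_neg (by lia), zero_mul]
  · rw [centralProd, binom_of_neg (show (n : ℤ) - k < 0 by lia), mul_zero]

/-- Vandermonde's identity, folded at the centre. -/
theorem binom_add_eq_sum_centralProd (m n K : ℕ) (hK : m + n ≤ K) :
    binom (2 * m + 2 * n) (m + n)
      = centralProd m n 0 + 2 * ∑ j ∈ range K, centralProd m n (j + 1) := by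
  rw [← sum_Icc_neg_of_even _ (centralProd_neg m n)]
  have hsub : Icc (-(n : ℤ)) m ⊆ Icc (-(K : ℤ)) K := Icc_subset_Icc (by lia) (by lia)
  rw [← sum_subset hsub]
  · have h := Nat.add_choose_eq (2 * m) (2 * n) (m + n)
    have h2 := binom_natCast (2 * m + 2 * n) (m + n)
    push_cast at h2
    rw [h2, h]
    push_cast
    -- The Vandermonde index i is m - k, and C(2n, n+k) = C(2n, n-k).
    refine sum_nbij' (fun x => (m : ℤ) - x.1) (fun k => ((m - k).toNat, (n + k).toNat))
      ?_ ?_ ?_ ?_ ?_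
    · simp only [mem_Icc, HasAntidiagonal.mem_antidiagonal]
      lia
    · simp only [mem_Icc, HasAntidiagonal.mem_antidiagonal]
      lia
    · rintro ⟨i, j⟩ hx
      simp only [HasAntidiagonal.mem_antidiagonal] at hx
      ext <;> dsimp only <;> lia
    · simp only [mem_Icc]
      lia
    · rintro ⟨i, j⟩ hx
      simp only [HasAntidiagonal.mem_antidiagonal] at hx
      have e1 := binom_natCast (2 * m) i
      have e2 := binom_natCast (2 * n) j
      push_cast at e1 e2
      dsimp only
      rw [centralProd, ← binom_central_neg n, ← e1, ← e2]
      congr 2 <;> lia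
  · intro k _ hk
    rw [mem_Icc, not_and_or] at hk
    rcases hk with hk | hk
    · rw [← centralProd_neg, centralProd_eq_zero (Or.inr (by lia))]
    · exact centralProd_eq_zero (Or.inl (by lia))

theorem centralProd_succ (m n : ℕ) (k : ℤ) :
    (m + k + 1) * (n + k + 1) * centralProd m n (k + 1)
      = (m - k) * (n - k) * centralProd m n k := by
  have h1 := binom_absorb (2 * m) (m - (k + 1))
  have h2 := binom_absorb (2 * n) (n - (k + 1))
  push_cast at h1 h2
  rw [show (m : ℤ) - (k + 1) + 1 = m - k by ring] at h1
  rw [show (n : ℤ) - (k + 1) + 1 = n - k by ring] at h2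
  rw [centralProd, centralProd]
  linear_combination (-(n - k) * binom (2 * n) (n - k)) * h1
    - ((2 * m - (m - (k + 1))) * binom (2 * m) (m - (k + 1))) * h2

/-- As (m+k)(n+k) - (m-k)(n-k) = 2k(m+n), `centralProd_succ` makes 2(m+n) k B_k a difference of
consecutive values of (m+k)(n+k) B_k. -/
theorem two_mul_add_mul_sum_mul_centralProd (m n K : ℕ) (hK : m ≤ K) :
    2 * ((m : ℤ) + n) * ∑ j ∈ range K, ((j : ℤ) + 1) * centralProd m n (j + 1)
      = m * n * centralProd m n 0 := by
  have h : ∀ K : ℕ, 2 * ((m : ℤ) + n) * ∑ j ∈ range K, ((j : ℤ) + 1) * centralProd m n (j + 1)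
      = m * n * centralProd m n 0
        - (m + K + 1) * (n + K + 1) * centralProd m n (K + 1) := by
    intro K
    induction K with
    | zero =>
      have := centralProd_succ m n 0
      simp only [add_zero, sub_zero, zero_add] at this
      simp [this]
    | succ K ih =>
      have := centralProd_succ m n (K + 1)
      rw [sum_range_succ, mul_add, ih]
      push_cast
      linear_combination this
  rw [h, centralProd_eq_zero (k := K + 1) (Or.inl (by lia)), mul_zero, sub_zero]

/-- The double sum as the tail `∑ (k - r) C(2m, m - k) C(2n, n - k)` over `k > r`. -/
theorem double_sum_eq_tail (m n r K : ℕ) (hK : m ≤ K) :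
    ∑ a ∈ Icc (1 : ℤ) ((m : ℤ) - r), ∑ b ∈ Icc (1 : ℤ) ((n : ℤ) - r),
        binom (2 * m - a + b - 1) (m - r - a) * binom (2 * n + a - b - 1) (n - r - b)
      = ∑ j ∈ range K, ((j : ℤ) + 1) * centralProd m n (r + j + 1) := by
  by_cases h : r ≤ m ∧ r ≤ n
  · obtain ⟨M, rfl⟩ := Nat.exists_eq_add_of_le h.1
    obtain ⟨N, rfl⟩ := Nat.exists_eq_add_of_le h.2
    rw [show ((r + M : ℕ) : ℤ) - r = M by push_cast; ring,
      show ((r + N : ℕ) : ℤ) - r = N by push_cast; ring, sum_Icc_one_eq_sum_range_reflect]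
    simp only [sum_Icc_one_eq_sum_range_reflect _ N]
    -- This p is m + n, so that p + M - N = 2m and p + N - M = 2n.
    have key := double_sum_eq_weightedSum K M N (2 * r + M + N) (by lia)
    rw [weightedSum] at key
    convert key using 1
    · refine sum_congr rfl fun i _ => sum_congr rfl fun j _ => ?_
      congr 2 <;> push_cast <;> ring
    · refine sum_congr rfl fun j _ => ?_
      rw [centralProd]
      congr 3 <;> push_cast <;> ring
  · rw [sum_eq_zero (s := range K) fun j _ => by
      rw [centralProd_eq_zero (by lia), mul_zero]]
    rw [not_and_or, not_le, not_le] at h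
    rcases h with h | h
    · rw [Icc_eq_empty (by lia), sum_empty]
    · refine sum_eq_zero fun a _ => ?_
      rw [Icc_eq_empty (by lia), sum_empty]

theorem corollary5 (m n r : ℕ) (hm : 0 < m) (hn : 0 < n) (hr : 0 < r) :
    ∑ a ∈ Finset.Icc (1 : ℤ) ((m : ℤ) - r), ∑ b ∈ Finset.Icc (1 : ℤ) ((n : ℤ) - r),
        (binom (2 * m - a + b - 1) (m - r - a) : ℚ) * (binom (2 * n + a - b - 1) (n - r - b) : ℚ)
      = ((m : ℚ) * n) / (2 * ((m : ℚ) + n)) * (binom (2 * m) m : ℚ) * (binom (2 * n) n : ℚ)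
        - (r : ℚ) / 2 * (binom (2 * m + 2 * n) (m + n) : ℚ)
        + (r : ℚ) / 2 * (binom (2 * m) m : ℚ) * (binom (2 * n) n : ℚ)
        + ∑ k ∈ Finset.Icc (1 : ℤ) ((r : ℤ) - 1),
            ((r : ℚ) - k) * (binom (2 * m) (m - k) : ℚ) * (binom (2 * n) (n - k) : ℚ) := by
  have hL := double_sum_eq_tail m n r (m + n) (by lia)
  have hV := binom_add_eq_sum_centralProd m n (r + (m + n)) (by lia)
  have hT := two_mul_add_mul_sum_mul_centralProd m n (r + (m + n)) (by lia)
  have hS : ∑ k ∈ Icc (1 : ℤ) ((r : ℤ) - 1), ((r : ℤ) - k) * centralProd m n k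
      = ∑ j ∈ range r, ((r : ℤ) - (j + 1)) * centralProd m n (j + 1) := by
    obtain ⟨s, rfl⟩ : ∃ s, r = s + 1 := ⟨r - 1, by lia⟩
    -- The extra term k = r on the right has weight 0.
    rw [sum_range_succ, show ((s + 1 : ℕ) : ℤ) - 1 = s by push_cast; ring,
      sum_Icc_one_eq_sum_range]
    simp
  have hsplit : ∑ j ∈ range (r + (m + n)), ((j : ℤ) + 1) * centralProd m n (j + 1)
      - r * ∑ j ∈ range (r + (m + n)), centralProd m n (j + 1)
      = ∑ j ∈ range (m + n), ((j : ℤ) + 1) * centralProd m n (r + j + 1)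
        - ∑ j ∈ range r, ((r : ℤ) - (j + 1)) * centralProd m n (j + 1) := by
    rw [mul_sum, ← sum_sub_distrib, sum_range_add, sub_eq_add_neg, add_comm, ← sum_neg_distrib]
    congr 1
    · refine sum_congr rfl fun j _ => ?_
      push_cast
      ring
    · exact sum_congr rfl fun j _ => by ring
  have h0 : centralProd m n 0 = binom (2 * m) m * binom (2 * n) n := by
    simp [centralProd]
  rw [← hL, ← hS] at hsplit
  rw [h0] at hV hT
  simp only [centralProd, ← mul_assoc] at hsplit
  have hV' := congrArg (Int.cast : ℤ → ℚ) hV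
  have hT' := congrArg (Int.cast : ℤ → ℚ) hT
  have hs' := congrArg (Int.cast : ℤ → ℚ) hsplit
  simp only [centralProd, ← mul_assoc] at hV' hT'
  push_cast at hV' hT' hs'
  have hmn : (m : ℚ) + n ≠ 0 := by positivity
  have hZ : ((m : ℚ) * n) / (2 * ((m : ℚ) + n)) * binom (2 * m) m * binom (2 * n) n
      = ∑ j ∈ range (r + (m + n)), ((j : ℚ) + 1) * binom (2 * m) (m - (j + 1))
          * binom (2 * n) (n - (j + 1)) := by
    field_simp
    linear_combination -hT'
  linear_combination -hs' - hZ + (r : ℚ) / 2 * hV'
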